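/- A (deterministic) $k$-OBDD over $n$ Boolean variables is a leveled oblivious branching program made of $k$ consecutive layers, each reading every variable exactly once, all layers in the same order; it has $kn+1$ levels of nodes (for $k=0$ it reads nothing and computes a constant), and its width is the maximal number of nodes of a level. Consider the following sets of width functions $w:\mathbb N\to\mathbb N$: $\mathtt{const}=\{w : w \text{ is constant},\ w>20\}$, $\mathtt{superpolylog}=\{w : w=O(\log^z n)\text{ for some constant } z\}$ and, for $0<\alpha<1/2$, $\mathtt{sublinear}_\alpha=\{w : w=O(n^\alpha)\}$. For $k=k(n)$ and such a set $C$ let $k\text{-}\mathrm{OBDD}_C$ be the set of all Boolean functions (families $(f_n)_n$ with $f_n:\{0,1\}^n\to\{0,1\}$) for which there is $v\in C$ such that every $f_n$ is computed by a $k(n)$-OBDD of width at most $v(n)$. **Theorem.** Let $C$ be $\mathtt{const}$, $\mathtt{superpolylog}$, or $\mathtt{sublinear}_\alpha$ with $0<\alpha<1/2$. Let $k=k(n)$ and $w=w(n)$ be natural-number valued with $w\in C$, $k w\log_2 w=o(n)$, and, for all sufficiently large $n$, $k>4$ and $w>20$. Let $r=r(n)$ be real valued such that for every $v\in C$ the inequality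 $$r(n)>\frac{48\,v(n)\log_2 v(n)}{w(n)\log_2 w(n)}$$ holds for all sufficiently large $n$ (how large may depend on $v$). Then $$\lfloor k/r\rfloor\text{-}\mathrm{OBDD}_C\subsetneq k\text{-}\mathrm{OBDD}_C .$$ -/

import Mathlib

open Filter Asymptotics

/-- A deterministic `k`-OBDD over the variables `x_0, …, x_{n-1}`: a leveled oblivious branching
program consisting of `k` consecutive layers, each of which reads all `n` variables exactly once,
all layers in the same order `order`. There are `k * n + 1` levels of nodes, `0, …, k * n`; level
`j` consists of `size j` nodes. Every node of a level `j < k * n` has exactly two outgoing edges,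
labeled by the two values of the variable read there; they lead to nodes of level `j + 1`.
The nodes of level `k * n` are the sinks, one of which is the accepting sink. For `k = 0`
there is a single level and nothing is read. -/
structure KOBDD (k n : ℕ) where
  /-- the order in which every layer reads the variables -/
  order : Equiv.Perm (Fin n)
  /-- the number of nodes of each level (only the levels `0, …, k * n` are relevant) -/
  size : ℕ → ℕ
  /-- the end point of the edge that leaves a given node of level `j` and has a given label -/
  next : ∀ j : ℕ, j < k * n → Bool → Fin (size j) → Fin (size (j + 1))
  /-- the source node -/
  source : Fin (size 0)
  /-- the accepting sink -/
  sink : Fin (size (k * n))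

namespace KOBDD

variable {k n : ℕ}

/-- The variable read at level `j`: level `j = i * n + p` with `p < n` belongs to layer `i`,
where it is the `p`-th one to be read. -/
def var (P : KOBDD k n) (j : ℕ) (hj : j < k * n) : Fin n :=
  P.order ⟨j % n, Nat.mod_lt _ (Nat.pos_of_ne_zero (by rintro rfl; simp at hj))⟩

/-- The node of level `j` on the computation path of `P` on the input `x`, that is, on the unique
path from the source all of whose edges are consistent with `x`. -/
def node (P : KOBDD k n) (x : Fin n → Bool) : ∀ j : ℕ, j ≤ k * n → Fin (P.size j)
  | 0, _ => P.source
  | j + 1, hj => P.next j hj (x (P.var j hj)) (P.node x j (Nat.le_of_succ_le hj))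

/-- `P` computes `f`: the value `f x` is `1` if and only if the path consistent with `x` leads
from the source to the accepting sink. -/
def Computes (P : KOBDD k n) (f : (Fin n → Bool) → Bool) : Prop :=
  ∀ x, f x = true ↔ P.node x (k * n) le_rfl = P.sink

/-- The width of `P`: the maximal number of nodes of a level. -/
def width (P : KOBDD k n) : ℕ := (Finset.range (k * n + 1)).sup P.size

end KOBDD

/-- A Boolean function in the asymptotic sense: one function of `n` Boolean variables for
every `n`. -/
abbrev BoolFun : Type := ∀ n : ℕ, (Fin n → Bool) → Bool

/-- The class `k-OBDD_C`, where `k = k(n)` and `C` is a set of width functions: the Boolean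
functions which for some `v ∈ C` are computed by `k(n)`-OBDDs of width (at most) `v(n)`. -/
def OBDDClass (k : ℕ → ℕ) (C : Set (ℕ → ℕ)) : Set BoolFun :=
  {f | ∃ v ∈ C, ∀ n, ∃ P : KOBDD (k n) n, P.width ≤ v n ∧ P.Computes (f n)}

/-- The constant widths greater than `20`. -/
def constWidth : Set (ℕ → ℕ) := {w | ∃ c : ℕ, 20 < c ∧ ∀ n, w n = c}

/-- The widths `w = O(log^z n)`, where `z` is any constant. -/
def superpolylogWidth : Set (ℕ → ℕ) :=
  {w | ∃ z : ℕ, (fun n : ℕ => (w n : ℝ)) =O[atTop] fun n : ℕ => (Real.logb 2 (n : ℝ)) ^ z}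

/-- The widths `w = O(n^α)`. -/
def sublinearWidth (α : ℝ) : Set (ℕ → ℕ) :=
  {w | (fun n : ℕ => (w n : ℝ)) =O[atTop] fun n : ℕ => (n : ℝ) ^ α}

/-!
The separating function is a table lookup. Put `p = ⌊log₂ w⌋ + 6` and `K = ⌊k / 3⌋`. The input holds
`K` tables, each with `2 ^ p` entries of `p` bits; since `k w log₂ w = o(n)`, there is room for them.
For each table, `2 p` linear forms over `𝔽₂` in all table bits supply an address and a test word, and
the function is the parity of the number of tables whose entry at the address equals the test word.

*Upper bound* (`exists_computes_lookup`). Three layers suffice for a table: the first sums up the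
address, the second replaces the address by the entry, the third adds the test word to the entry and
compares the sum with zero. The state consists of `p` bits and a bounded amount of information, so
the width is `O(2 ^ p) = O(w)`, and each of the classes `C` is closed under constant factors.

*Lower bound* (`two_pow_le_of_computes_lookup`). A `k'`-OBDD of width `v`, cut at the same position
of every layer, distinguishes at most `v ^ (v k')` assignments of the variables before the cut
(`KOBDD.exists_signature`). Take the cut before which one sixteenth of the table bits is read. The
linear forms generate a code of rate at most `1 / 512` and minimum distance more than an eighth of
the length, which exists by the Gilbert–Varshamov bound (`exists_code`). Hence, whatever the order
of the variables, the variables after the cut can give all forms any prescribed values, and so query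
any entry and compare it with any word. Two assignments before the cut that agree on the forms are
therefore distinguished by the function (`exists_separating`), which gives
`k' v log₂ v ≥ k w log₂ w / 48`. For `k' = ⌊k / r⌋` this contradicts the hypothesis on `r`.

The inclusion of the classes comes from idle layers. For the finitely many `n` with
`⌊k / r⌋ > k`, an arbitrary function is computed with width `2 ^ n`.
-/

/-! ### Branching programs as runs of a state machine -/

namespace KOBDD

variable {k n : ℕ}

/-- The bit that a program with variable order `π` reads at level `j` on the input `x`. For
`n = 0` nothing is ever read, and the value is irrelevant. -/
def bitAt (π : Equiv.Perm (Fin n)) (x : Fin n → Bool) (j : ℕ) : Bool :=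
  if h : 0 < n then x (π ⟨j % n, Nat.mod_lt _ h⟩) else false

/-- The state after `j` steps of the machine with transitions `step` which is started in `s₀` and
fed the bits `β 0, β 1, …`. -/
def run {S : Type*} (step : ℕ → Bool → S → S) (s₀ : S) (β : ℕ → Bool) : ℕ → S
  | 0 => s₀
  | j + 1 => step j (β j) (run step s₀ β j)

section run

variable {S : Type*}

theorem run_add (step : ℕ → Bool → S → S) (s₀ : S) (β : ℕ → Bool) (a q : ℕ) :
    run step s₀ β (a + q) =
      run (fun j => step (a + j)) (run step s₀ β a) (fun j => β (a + j)) q := by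
  induction q with
  | zero => rfl
  | succ q ih => rw [← Nat.add_assoc, run, run, ih]

theorem run_congr {step step' : ℕ → Bool → S → S} {s₀ : S} {β β' : ℕ → Bool} {q : ℕ}
    (hs : ∀ j < q, step j = step' j) (hβ : ∀ j < q, β j = β' j) :
    run step s₀ β q = run step' s₀ β' q := by
  induction q with
  | zero => rfl
  | succ q ih =>
    rw [run, run, ih (fun j hj => hs j (by omega)) (fun j hj => hβ j (by omega)),
      hs q (by omega), hβ q (by omega)]

end run

theorem var_eq_bitAt (P : KOBDD k n) (x : Fin n → Bool) (j : ℕ) (hj : j < k * n) :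
    x (P.var j hj) = bitAt P.order x j := by
  have hn : 0 < n := Nat.pos_of_ne_zero (by rintro rfl; simp at hj)
  simp [bitAt, var, hn]

theorem exists_run_of_computes {v : ℕ} {f : (Fin n → Bool) → Bool} (P : KOBDD k n)
    (hv : P.width ≤ v) (hP : P.Computes f) :
    ∃ (π : Equiv.Perm (Fin n)) (step : ℕ → Bool → Fin v → Fin v) (s₀ t : Fin v),
      ∀ x, f x = true ↔ run step s₀ (bitAt π x) (k * n) = t := by
  have hsize : ∀ j ≤ k * n, P.size j ≤ v := fun j hj =>
    (Finset.le_sup (f := P.size) (Finset.mem_range.2 (Nat.lt_succ_of_le hj))).trans hv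
  let step : ℕ → Bool → Fin v → Fin v := fun j b s =>
    if h : j < k * n ∧ s.val < P.size j then
      Fin.castLE (hsize (j + 1) h.1) (P.next j h.1 b ⟨s, h.2⟩) else s
  let s₀ : Fin v := Fin.castLE (hsize 0 (Nat.zero_le _)) P.source
  have key : ∀ x j (hj : j ≤ k * n),
      run step s₀ (bitAt P.order x) j = Fin.castLE (hsize j hj) (P.node x j hj) := by
    intro x j
    induction j with
    | zero => intro hj; rfl
    | succ j ih =>
      intro hj
      rw [run, ih (by omega), node, ← var_eq_bitAt P x j hj]
      have h : j < k * n ∧ (P.node x j (by omega)).val < P.size j := ⟨hj, Fin.is_lt _⟩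
      simp [step, h.1]
  refine ⟨P.order, step, s₀, Fin.castLE (hsize _ le_rfl) P.sink, fun x => ?_⟩
  rw [hP x, key x _ le_rfl]
  simp [Fin.ext_iff]

theorem exists_computes_of_run {v : ℕ} {f : (Fin n → Bool) → Bool} {S : Type*} [Fintype S]
    (hS : Fintype.card S ≤ v) (π : Equiv.Perm (Fin n)) (step : ℕ → Bool → S → S) (s₀ t : S)
    (h : ∀ x, f x = true ↔ run step s₀ (bitAt π x) (k * n) = t) :
    ∃ P : KOBDD k n, P.width ≤ v ∧ P.Computes f := by
  let e := Fintype.equivFin S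
  let P : KOBDD k n :=
    { order := π
      size := fun _ => Fintype.card S
      next := fun j _ b s => e (step j b (e.symm s))
      source := e s₀
      sink := e t }
  have key : ∀ x j (hj : j ≤ k * n), P.node x j hj = e (run step s₀ (bitAt π x) j) := by
    intro x j
    induction j with
    | zero => intro hj; rfl
    | succ j ih =>
      intro hj
      rw [node, ih, var_eq_bitAt P x j hj]
      change e (step j _ (e.symm (e _))) = _
      rw [e.symm_apply_apply]
      rfl
  refine ⟨P, ?_, fun x => ?_⟩
  · exact Finset.sup_le fun j _ => hS
  · rw [h x, key]
    exact e.apply_eq_iff_eq.symm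

/-! ### Counting subfunctions at a cut -/

/-- What the variables read before the cut contribute to a computation is, for each of the `k`
layers, a map from the nodes at the start of the layer to the nodes at the cut. So at most
`(v ^ v) ^ k` classes of assignments before the cut can be told apart by what follows. -/
theorem exists_signature {v : ℕ} {f : (Fin n → Bool) → Bool} (P : KOBDD k n)
    (hv : P.width ≤ v) (hP : P.Computes f) :
    ∃ π : Equiv.Perm (Fin n), ∀ u ≤ n,
      ∃ sig : (Fin n → Bool) → Fin k → Fin v → Fin v,
        (∀ x y, (∀ j : Fin n, j.val < u → x (π j) = y (π j)) → sig x = sig y) ∧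
        ∀ x y, (∀ j : Fin n, u ≤ j.val → x (π j) = y (π j)) → sig x = sig y → f x = f y := by
  obtain ⟨π, step, s₀, t, h⟩ := exists_run_of_computes P hv hP
  refine ⟨π, fun u hu => ⟨fun x i s =>
    run (fun j => step (i * n + j)) s (fun j => bitAt π x (i * n + j)) u, ?_, ?_⟩⟩
  · intro x y hxy
    funext i s
    refine run_congr (fun _ _ => rfl) fun j hj => ?_
    have hn : 0 < n := by omega
    have hm : (i * n + j) % n = j := by
      rw [Nat.mul_comm, Nat.mul_add_mod, Nat.mod_eq_of_lt (by omega)]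
    simpa [bitAt, hn, hm] using hxy ⟨j, by omega⟩ hj
  · intro x y hxy hsig
    have key : ∀ i ≤ k, run step s₀ (bitAt π x) (i * n) = run step s₀ (bitAt π y) (i * n) := by
      intro i
      induction i with
      | zero => intro _; simp [run]
      | succ i ih =>
        intro hi
        have hcut : run step s₀ (bitAt π x) (i * n + u) = run step s₀ (bitAt π y) (i * n + u) := by
          rw [run_add, run_add, ih (by omega)]
          exact congrFun (congrFun hsig ⟨i, hi⟩) _
        have he : (i + 1) * n = i * n + u + (n - u) := by
          rw [Nat.add_mul]; omega
        rw [he, run_add _ _ _ (i * n + u), run_add _ _ _ (i * n + u), hcut]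
        refine run_congr (fun _ _ => rfl) fun j hj => ?_
        have hn : 0 < n := by omega
        have hm : (i * n + u + j) % n = u + j := by
          rw [Nat.add_assoc, Nat.mul_comm, Nat.mul_add_mod, Nat.mod_eq_of_lt (by omega)]
        simpa [bitAt, hn, hm] using hxy ⟨u + j, by omega⟩ (by simp)
    have := key k le_rfl
    rw [Bool.eq_iff_iff, h x, h y, this]

/-! ### Padding with idle layers, and programs for arbitrary functions -/

theorem exists_computes_of_le {k' v : ℕ} {f : (Fin n → Bool) → Bool} (hk : k' * n ≤ k * n)
    (P : KOBDD k' n) (hv : P.width ≤ v) (hP : P.Computes f) :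
    ∃ Q : KOBDD k n, Q.width ≤ v ∧ Q.Computes f := by
  obtain ⟨π, step, s₀, t, h⟩ := exists_run_of_computes P hv hP
  refine exists_computes_of_run (Fintype.card_fin v).le π
    (fun j b s => if j < k' * n then step j b s else s) s₀ t fun x => ?_
  rw [h x]
  have idle : ∀ d, run (fun j b s => if j < k' * n then step j b s else s) s₀ (bitAt π x)
      (k' * n + d) = run step s₀ (bitAt π x) (k' * n) := by
    intro d
    induction d with
    | zero =>
      refine run_congr (fun j hj => ?_) fun _ _ => rfl
      funext b s
      exact if_pos hj
    | succ d ih =>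
      rw [← Nat.add_assoc, run, ih]
      simp
  rw [← idle (k * n - k' * n), Nat.add_sub_cancel' hk]

theorem exists_computes_false (k n : ℕ) :
    ∃ P : KOBDD k n, P.width ≤ 2 ∧ P.Computes fun _ => false := by
  refine exists_computes_of_run (S := Bool) (by simp) 1 (fun _ _ s => s) false true fun x => ?_
  have : ∀ j, run (fun _ _ s => s) false (bitAt 1 x) j = false := by
    intro j
    induction j with
    | zero => rfl
    | succ j ih => rw [run, ih]
  simp [this]

/-- The machine that works in layers: at the `q`-th level of layer `i` it performs `core i q`, and
at the last level of layer `i` it applies `post i` in addition. -/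
def layerStep {S : Type*} (n : ℕ) (core : ℕ → ℕ → Bool → S → S) (post : ℕ → S → S)
    (j : ℕ) (b : Bool) (s : S) : S :=
  if j % n + 1 = n then post (j / n) (core (j / n) (j % n) b s) else core (j / n) (j % n) b s

theorem run_layerStep {S : Type*} (hn : 0 < n) (core : ℕ → ℕ → Bool → S → S) (post : ℕ → S → S)
    (s₀ : S) (x : Fin n → Bool) (i : ℕ) :
    run (layerStep n core post) s₀ (bitAt 1 x) ((i + 1) * n) =
      post i (run (core i) (run (layerStep n core post) s₀ (bitAt 1 x) (i * n)) (bitAt 1 x) n) := by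
  obtain ⟨m, rfl⟩ : ∃ m, n = m + 1 := ⟨n - 1, by omega⟩
  have hm : ∀ j < m + 1, (i * (m + 1) + j) % (m + 1) = j := fun j hj => by
    rw [Nat.mul_comm, Nat.mul_add_mod, Nat.mod_eq_of_lt hj]
  have hd : ∀ j < m + 1, (i * (m + 1) + j) / (m + 1) = i := fun j hj => by
    rw [Nat.mul_comm, Nat.mul_add_div (by omega), Nat.div_eq_of_lt hj, Nat.add_zero]
  have hb : ∀ j < m + 1, bitAt 1 x (i * (m + 1) + j) = bitAt 1 x j := fun j hj => by
    simp [bitAt, hm j hj, Nat.mod_eq_of_lt hj]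
  rw [Nat.add_mul, Nat.one_mul, run_add]
  set s := run (layerStep (m + 1) core post) s₀ (bitAt 1 x) (i * (m + 1))
  rw [run, run, hb m (by omega),
    run_congr (step' := core i) (β' := bitAt 1 x) (fun j hj => ?_) fun j hj => hb j (by omega)]
  · simp [layerStep, hm m (by omega), hd m (by omega)]
  · funext b s
    simp [layerStep, hm j (by omega), hd j (by omega), hj.ne]

theorem exists_computes_any (hk : 0 < k) (hn : 0 < n) (f : (Fin n → Bool) → Bool) :
    ∃ P : KOBDD k n, P.width ≤ 2 ^ n ∧ P.Computes f := by
  classical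
  -- One layer stores the whole input; its last step replaces it by the value of `f`.
  let core : ℕ → ℕ → Bool → (Fin n → Bool) → Fin n → Bool :=
    fun _ q b s j => if j.val = q then b else s j
  let post : ℕ → (Fin n → Bool) → Fin n → Bool := fun _ s _ => f s
  have h1 : ∃ P : KOBDD 1 n, P.width ≤ 2 ^ n ∧ P.Computes f := by
    refine exists_computes_of_run (S := Fin n → Bool) (by simp) 1
      (layerStep n core post) (fun _ => false) (fun _ => true) fun x => ?_
    have hcore : ∀ q ≤ n, run (core 0) (fun _ => false) (bitAt 1 x) q =
        fun j => if j.val < q then x j else false := by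
      intro q
      induction q with
      | zero => intro _; simp [run]
      | succ q ih =>
        intro hq
        rw [run, ih (by omega)]
        funext j
        by_cases hj : j.val = q
        · subst hj
          simp [core, bitAt, hn, Nat.mod_eq_of_lt j.isLt]
        · have : j.val < q + 1 ↔ j.val < q := by omega
          simp [core, hj, this]
    have hrun := run_layerStep hn core post (fun _ => false) x 0
    rw [Nat.zero_mul, Nat.zero_add] at hrun
    rw [hrun, show run (layerStep n core post) (fun _ => false) (bitAt 1 x) 0 = fun _ => false
      from rfl, hcore n le_rfl]
    simp only [Fin.is_lt, if_true, post]
    exact ⟨fun h => funext fun _ => h, fun h => congrFun h ⟨0, hn⟩⟩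
  obtain ⟨P, hv, hP⟩ := h1
  exact exists_computes_of_le (Nat.mul_le_mul_right n hk) P hv hP

end KOBDD

/-! ### The width classes -/

theorem isBigO_const_mul_add {v : ℕ → ℕ} {g : ℕ → ℝ}
    (hg : ∀ᶠ n in atTop, 1 ≤ g n) (hv : (fun n => (v n : ℝ)) =O[atTop] g) (c d : ℕ) :
    (fun n => ((c * v n + d : ℕ) : ℝ)) =O[atTop] g := by
  have hd : (fun _ : ℕ => (d : ℝ)) =O[atTop] g := by
    refine IsBigO.of_bound d ?_
    filter_upwards [hg] with n hn
    rw [Real.norm_of_nonneg (Nat.cast_nonneg d)]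
    exact le_mul_of_one_le_right (Nat.cast_nonneg d) (hn.trans (le_abs_self _))
  simpa using (hv.const_mul_left (c : ℝ)).add hd

theorem mul_add_mem_width {C : Set (ℕ → ℕ)}
    (hC : C = constWidth ∨ C = superpolylogWidth ∨
      ∃ α : ℝ, 0 < α ∧ α < 1 / 2 ∧ C = sublinearWidth α)
    {v : ℕ → ℕ} (hv : v ∈ C) {c : ℕ} (hc : 1 ≤ c) (d : ℕ) : (fun n => c * v n + d) ∈ C := by
  rcases hC with rfl | rfl | ⟨α, hα, -, rfl⟩
  · obtain ⟨m, hm, h⟩ := hv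
    exact ⟨c * m + d, by nlinarith, fun n => by simp [h n]⟩
  · obtain ⟨z, hz⟩ := hv
    refine ⟨z, isBigO_const_mul_add ?_ hz c d⟩
    filter_upwards [eventually_ge_atTop 2] with n hn
    refine one_le_pow₀ ?_
    rw [Real.le_logb_iff_rpow_le one_lt_two (by positivity)]
    simpa using hn
  · refine isBigO_const_mul_add ?_ hv c d
    filter_upwards [eventually_ge_atTop 1] with n hn
    exact Real.one_le_rpow (by exact_mod_cast hn) hα.le

/-- For the finitely many `n` with `k' n > k n`, at least one layer is available by `hzero`, and it
suffices to compute any function with width `2 ^ n`. -/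
theorem OBDDClass_subset_of_eventually_le {C : Set (ℕ → ℕ)}
    (hC : ∀ v ∈ C, ∀ d : ℕ, (fun n => v n + d) ∈ C) {k' k : ℕ → ℕ}
    (hle : ∀ᶠ n in atTop, k' n ≤ k n) (hzero : ∀ n, k n = 0 → k' n = 0) :
    OBDDClass k' C ⊆ OBDDClass k C := by
  rintro f ⟨v, hv, h⟩
  obtain ⟨N, hN⟩ := eventually_atTop.1 hle
  refine ⟨_, hC v hv (2 ^ N), fun n => ?_⟩
  obtain ⟨P, hPv, hP⟩ := h n
  by_cases hkn : k' n * n ≤ k n * n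
  · obtain ⟨Q, hQv, hQ⟩ := KOBDD.exists_computes_of_le hkn P hPv hP
    exact ⟨Q, hQv.trans (Nat.le_add_right _ _), hQ⟩
  · have hn : 0 < n := Nat.pos_of_ne_zero fun h0 => hkn (by simp [h0])
    have hk : 0 < k n := Nat.pos_of_ne_zero fun h0 => hkn (by simp [hzero n h0])
    have hnN : n ≤ N := by
      by_contra hlt
      exact hkn (Nat.mul_le_mul_right n (hN n (by omega)))
    obtain ⟨Q, hQv, hQ⟩ := KOBDD.exists_computes_any hk hn (f n)
    exact ⟨Q, hQv.trans ((Nat.pow_le_pow_right two_pos hnN).trans (Nat.le_add_left _ _)), hQ⟩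

/-! ### Binary linear codes of large minimum distance -/

section Code

variable {ι : Type*} [Fintype ι]

/-- The Chernoff bound for the volume of a Hamming ball, with parameter `1 / 16`. -/
theorem card_hammingNorm_le_mul_pow_le [DecidableEq ι] (d : ℕ) :
    (Finset.univ.filter fun y : ι → ZMod 2 => hammingNorm y ≤ d).card * 16 ^ Fintype.card ι ≤
      17 ^ Fintype.card ι * 16 ^ d := by
  have hz : ∀ z : ZMod 2, z = 0 ∨ z = 1 := by decide
  have hsum : ∑ y : ι → ZMod 2, 16 ^ (Fintype.card ι - hammingNorm y) =
      17 ^ Fintype.card ι := by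
    have h := Finset.prod_univ_sum (fun _ : ι => (Finset.univ : Finset (ZMod 2)))
      (fun _ z => if z = 0 then 16 else 1)
    have h17 : ∑ z : ZMod 2, (if z = 0 then 16 else 1) = 17 := by decide
    rw [Finset.prod_congr rfl fun _ _ => h17, Finset.prod_const, Finset.card_univ,
      Fintype.piFinset_univ] at h
    rw [h]
    refine Finset.sum_congr rfl fun y _ => ?_
    rw [Finset.prod_ite, Finset.prod_const, Finset.prod_const_one, mul_one]
    congr 1
    rw [hammingNorm]
    have := Finset.card_filter_add_card_filter_not (s := (Finset.univ : Finset ι))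
      (fun i => y i = 0)
    rw [Finset.card_univ] at this
    simp only [ne_eq]
    omega
  calc _ = ∑ y : ι → ZMod 2 with hammingNorm y ≤ d, 16 ^ Fintype.card ι := by
        rw [Finset.sum_const, smul_eq_mul]
    _ ≤ ∑ y : ι → ZMod 2 with hammingNorm y ≤ d, 16 ^ (Fintype.card ι - hammingNorm y) * 16 ^ d := by
        refine Finset.sum_le_sum fun y hy => ?_
        rw [← pow_add]
        refine Nat.pow_le_pow_right (by norm_num) ?_
        have := (Finset.mem_filter.1 hy).2
        omega
    _ ≤ ∑ y : ι → ZMod 2, 16 ^ (Fintype.card ι - hammingNorm y) * 16 ^ d :=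
        Finset.sum_le_sum_of_subset (Finset.filter_subset _ _)
    _ = _ := by rw [← Finset.sum_mul, hsum]

/-- The Gilbert–Varshamov bound: as long as the balls of radius `d` around the codewords do not
cover the space, a further generator can be added. -/
theorem exists_code_fin [DecidableEq ι] (d m : ℕ)
    (h : 2 ^ m * (Finset.univ.filter fun y : ι → ZMod 2 => hammingNorm y ≤ d).card ≤
      2 ^ Fintype.card ι) :
    ∃ g : Fin m → ι → ZMod 2, ∀ c : Fin m → ZMod 2, c ≠ 0 → d < hammingNorm (∑ r, c r • g r) := by
  induction m with
  | zero => exact ⟨Fin.elim0, fun c hc => (hc (Subsingleton.elim _ _)).elim⟩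
  | succ m ih =>
    set B := Finset.univ.filter fun y : ι → ZMod 2 => hammingNorm y ≤ d with hB
    have hBpos : 0 < B.card := Finset.card_pos.2 ⟨0, by simp [hB]⟩
    rw [pow_succ, mul_assoc] at h
    obtain ⟨g, hg⟩ := ih ((Nat.mul_le_mul_left _ (by omega)).trans h)
    have hz : ∀ z : ZMod 2, z = 0 ∨ z = 1 := by decide
    -- A word outside all balls around codewords.
    have hnot : ∃ y : ι → ZMod 2, ∀ c : Fin m → ZMod 2, d < hammingNorm (y + ∑ r, c r • g r) := by
      by_contra hcon
      push Not at hcon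
      have hcov : (Finset.univ : Finset (ι → ZMod 2)) ⊆
          ((Finset.univ : Finset (Fin m → ZMod 2)) ×ˢ B).image
            fun q => q.2 - ∑ r, q.1 r • g r := by
        intro y _
        obtain ⟨c, hc⟩ := hcon y
        exact Finset.mem_image.2 ⟨(c, y + ∑ r, c r • g r), by simp [hB, hc], by simp⟩
      have := (Finset.card_le_card hcov).trans Finset.card_image_le
      rw [Finset.card_product, Finset.card_univ, Finset.card_univ, Fintype.card_fun,
        Fintype.card_fun, ZMod.card, Fintype.card_fin] at this
      have : 2 ^ m * B.card < 2 ^ m * (2 * B.card) := by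
        apply Nat.mul_lt_mul_of_pos_left (by omega) (by positivity)
      omega
    obtain ⟨y, hy⟩ := hnot
    refine ⟨Fin.cons y g, fun c hc => ?_⟩
    rw [Fin.sum_univ_succ]
    simp only [Fin.cons_zero, Fin.cons_succ]
    rcases hz (c 0) with h0 | h0
    · rw [h0, zero_smul, zero_add]
      refine hg (fun r => c r.succ) fun hc' => hc ?_
      funext r
      refine Fin.cases h0 (fun r => congrFun hc' r) r
    · rw [h0, one_smul]
      exact hy _

theorem exists_code [DecidableEq ι] {R : Type*} [Fintype R] {τ : ℕ} (hτ : 0 < τ)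
    (hι : Fintype.card ι = 1024 * τ) (hR : Fintype.card R ≤ 2 * τ) :
    ∃ g : R → ι → ZMod 2, ∀ c : R → ZMod 2, c ≠ 0 →
      128 * τ < hammingNorm (∑ r, c r • g r) := by
  have hcard : 2 ^ Fintype.card R *
      (Finset.univ.filter fun y : ι → ZMod 2 => hammingNorm y ≤ 128 * τ).card ≤
      2 ^ Fintype.card ι := by
    have h := card_hammingNorm_le_mul_pow_le (ι := ι) (128 * τ)
    set N := (Finset.univ.filter fun y : ι → ZMod 2 => hammingNorm y ≤ 128 * τ).card
    rw [hι] at h ⊢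
    have h17 : 17 ^ (1024 * τ) ≤ 2 ^ (128 * τ) * 16 ^ (1024 * τ) := by
      calc 17 ^ (1024 * τ) = (17 ^ 8) ^ (128 * τ) := by rw [← pow_mul]; congr 1; ring
        _ ≤ (2 * 16 ^ 8) ^ (128 * τ) := Nat.pow_le_pow_left (by norm_num) _
        _ = 2 ^ (128 * τ) * 16 ^ (1024 * τ) := by
          rw [mul_pow, ← pow_mul]; congr 2; ring
    have h16 : 0 < 16 ^ (1024 * τ) := by positivity
    refine Nat.le_of_mul_le_mul_right ?_ h16
    calc 2 ^ Fintype.card R * N * 16 ^ (1024 * τ)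
        = 2 ^ Fintype.card R * (N * 16 ^ (1024 * τ)) := mul_assoc _ _ _
      _ ≤ 2 ^ (2 * τ) * ((2 ^ (128 * τ) * 16 ^ (1024 * τ)) * 16 ^ (128 * τ)) :=
          Nat.mul_le_mul (Nat.pow_le_pow_right two_pos hR)
            (h.trans (Nat.mul_le_mul_right _ h17))
      _ = 2 ^ (642 * τ) * 16 ^ (1024 * τ) := by
          rw [show (16 : ℕ) ^ (128 * τ) = 2 ^ (512 * τ) by
            rw [show (16 : ℕ) = 2 ^ 4 by norm_num, ← pow_mul]; congr 1; ring,
            show 642 * τ = 2 * τ + 128 * τ + 512 * τ by ring, pow_add, pow_add]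
          ring
      _ ≤ _ := Nat.mul_le_mul_right _ (Nat.pow_le_pow_right two_pos (by omega))
  obtain ⟨g, hg⟩ := exists_code_fin (ι := ι) (128 * τ) (Fintype.card R) hcard
  let e := Fintype.equivFin R
  refine ⟨fun r => g (e r), fun c hc => ?_⟩
  have hsum : ∑ r, c r • g (e r) = ∑ r, c (e.symm r) • g r := by
    rw [← e.sum_comp]; simp
  rw [hsum]
  refine hg (fun r => c (e.symm r)) fun h0 => hc ?_
  funext r
  simpa using congrFun h0 (e r)

/-- A linear system over a field can be solved with support in `s` if no nontrivial combination
of its rows vanishes on `s`. -/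
theorem exists_solution_supported {F R : Type*} [Field F] [Fintype R] (s : Set ι)
    (a : R → ι → F) (ha : ∀ c : R → F, c ≠ 0 → ∃ t ∈ s, (∑ r, c r • a r) t ≠ 0) (b : R → F) :
    ∃ σ : ι → F, (∀ t ∉ s, σ t = 0) ∧ ∀ r, ∑ t, a r t * σ t = b r := by
  classical
  let W : Submodule F (ι → F) :=
    { carrier := {σ | ∀ t ∉ s, σ t = 0}
      add_mem' := fun hx hy t ht => by simp [hx t ht, hy t ht]
      zero_mem' := fun t _ => rfl
      smul_mem' := fun c x hx t ht => by simp [hx t ht] }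
  let Φ : (ι → F) →ₗ[F] (R → F) := Matrix.mulVecLin (Matrix.of a)
  have htop : W.map Φ = ⊤ := by
    by_contra hne
    obtain ⟨φ, hφ, hker⟩ := Submodule.exists_le_ker_of_lt_top _ (lt_top_iff_ne_top.2 hne)
    let c : R → F := fun r => φ (Pi.single r 1)
    have hφc : ∀ z : R → F, φ z = ∑ r, z r * c r := fun z => by
      rw [LinearMap.pi_apply_eq_sum_univ φ z]
      refine Finset.sum_congr rfl fun r _ => ?_
      rw [smul_eq_mul]
      congr 2
      funext j
      simp [Pi.single_apply, eq_comm]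
    have hc : c ≠ 0 := by
      rintro hc
      exact hφ (LinearMap.ext fun z => by simp [hφc, hc])
    obtain ⟨t, hts, ht⟩ := ha c hc
    refine ht ?_
    have hmem : Φ (Pi.single t 1) ∈ W.map Φ := by
      refine Submodule.mem_map_of_mem fun t' ht' => ?_
      exact Pi.single_eq_of_ne (by rintro rfl; exact ht' hts) _
    have h0 := LinearMap.mem_ker.1 (hker hmem)
    rw [hφc] at h0
    rw [Finset.sum_apply, ← h0]
    refine Finset.sum_congr rfl fun r _ => ?_
    simp [Φ, mul_comm]
  obtain ⟨σ, hσ, hb⟩ := Submodule.mem_map.1 (htop ▸ Submodule.mem_top : b ∈ W.map Φ)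
  exact ⟨σ, hσ, fun r => by rw [← hb]; rfl⟩

end Code

/-! ### The hard function -/

section TableLookup

variable {ι : Type*} [Fintype ι] {K p : ℕ}

/-- The address with which table `i` is queried on the input `y`; its bits are the linear forms
`g (false, i, b)`. -/
def lookupAddress (g : Bool × Fin K × Fin p → ι → ZMod 2) (i : Fin K) (y : ι → ZMod 2) :
    Fin p → ZMod 2 :=
  fun b => ∑ t, g (false, i, b) t * y t

/-- The sum of the test word of table `i`, whose bits are the linear forms `g (true, i, b)`, and
of the entry of table `i` at the queried address. The entry of table `i` at the address `a` consists
of the `p` input bits at the places `pos i a b`. In characteristic two the sum vanishes if and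
only if the entry equals the test word. -/
def lookupMismatch (pos : Fin K → (Fin p → ZMod 2) → Fin p → ι)
    (g : Bool × Fin K × Fin p → ι → ZMod 2) (i : Fin K) (y : ι → ZMod 2) : Fin p → ZMod 2 :=
  fun b => ∑ t, g (true, i, b) t * y t + y (pos i (lookupAddress g i y) b)

/-- The table lookup function: the parity of the number of tables whose queried entry equals the
test word. -/
def lookupParity (pos : Fin K → (Fin p → ZMod 2) → Fin p → ι)
    (g : Bool × Fin K × Fin p → ι → ZMod 2) (y : ι → ZMod 2) : Bool :=
  decide (∑ i, (if lookupMismatch pos g i y = 0 then (1 : ZMod 2) else 0) = 1)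

/-- Two inputs that differ at some place and agree on all linear forms are separated by a change
of variables outside `L`, provided that the code generated by the forms has large minimum distance:
the addresses can be set so that a differing entry is queried, and the test words so that just this
table finds a match on the first input, and no table does on the second. -/
theorem exists_separating [DecidableEq ι] {pos : Fin K → (Fin p → ZMod 2) → Fin p → ι}
    (hpos : ∀ t, ∃ i a b, pos i a b = t) {g : Bool × Fin K × Fin p → ι → ZMod 2} (hp : 2 ≤ p)
    (L : Finset ι) (hg : ∀ c : Bool × Fin K × Fin p → ZMod 2, c ≠ 0 →
      L.card + K * p < hammingNorm (∑ r, c r • g r))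
    {ρ ρ' : ι → ZMod 2} (hne : ρ ≠ ρ') (hlin : ∀ r, ∑ t, g r t * ρ t = ∑ t, g r t * ρ' t) :
    ∃ σ : ι → ZMod 2, (∀ t ∈ L, σ t = 0) ∧
      lookupParity pos g (ρ + σ) ≠ lookupParity pos g (ρ' + σ) := by
  obtain ⟨t₀, ht₀⟩ := Function.ne_iff.1 hne
  obtain ⟨i, a, b₀, rfl⟩ := hpos t₀
  let ad : Fin K → Fin p → ZMod 2 := fun j => if j = i then a else 0
  let δ : Fin K → Fin p → ZMod 2 := fun j b => ρ' (pos j (ad j) b) - ρ (pos j (ad j) b)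
  -- The values of the mismatches on the first input.
  have hs : ∀ j, ∃ s : Fin p → ZMod 2, (s = 0 ↔ j = i) ∧ s + δ j ≠ 0 := by
    intro j
    by_cases hj : j = i
    · subst hj
      refine ⟨0, by simp, fun h => ht₀ ?_⟩
      have := congrFun h b₀
      simp only [zero_add, δ, ad, if_true, Pi.zero_apply] at this
      exact (sub_eq_zero.1 this).symm
    · have hcard : ({0, -δ j} : Finset (Fin p → ZMod 2)).card <
          (Finset.univ : Finset (Fin p → ZMod 2)).card := by
        have h4 : 2 ^ 2 ≤ 2 ^ p := Nat.pow_le_pow_right two_pos hp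
        rw [Finset.card_univ, Fintype.card_fun, ZMod.card, Fintype.card_fin]
        exact Finset.card_le_two.trans_lt (by omega)
      obtain ⟨s, -, hs⟩ := Finset.exists_mem_notMem_of_card_lt_card hcard
      rw [Finset.mem_insert, Finset.mem_singleton, not_or] at hs
      exact ⟨s, by simp [hs.1, hj], fun h => hs.2 (eq_neg_of_add_eq_zero_left h)⟩
  choose s hs0 hsδ using hs
  let A : Bool × Fin K × Fin p → ι → ZMod 2 := fun r =>
    g r + if r.1 then Pi.single (pos r.2.1 (ad r.2.1) r.2.2) 1 else 0
  let tgt : Bool × Fin K × Fin p → ZMod 2 := fun r =>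
    (if r.1 then s r.2.1 r.2.2 else ad r.2.1 r.2.2) - ∑ t, A r t * ρ t
  -- The rows of `A` are those of `g` up to at most `K * p` places.
  have hA : ∀ c : Bool × Fin K × Fin p → ZMod 2, c ≠ 0 →
      ∃ t ∈ ((L : Set ι)ᶜ), (∑ r, c r • A r) t ≠ 0 := by
    intro c hc
    by_contra hcon
    push Not at hcon
    refine (hg c hc).not_ge ?_
    let S : Finset ι := (Finset.univ : Finset (Fin K × Fin p)).image
      fun q => pos q.1 (ad q.1) q.2
    have hS : S.card ≤ K * p := Finset.card_image_le.trans (by simp)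
    refine (Finset.card_le_card (t := L ∪ S) fun t ht => ?_).trans
      ((Finset.card_union_le _ _).trans (Nat.add_le_add_left hS _))
    by_contra hLS
    rw [Finset.mem_union, not_or] at hLS
    have h0 := hcon t (by simpa using hLS.1)
    refine (Finset.mem_filter.1 ht).2 ?_
    rw [← h0, Finset.sum_apply, Finset.sum_apply]
    refine Finset.sum_congr rfl fun r _ => ?_
    have : (if r.1 then (Pi.single (pos r.2.1 (ad r.2.1) r.2.2) 1 : ι → ZMod 2) else 0) t = 0 := by
      split_ifs
      · refine Pi.single_eq_of_ne (fun h => hLS.2 ?_) _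
        exact Finset.mem_image.2 ⟨r.2, Finset.mem_univ _, h.symm⟩
      · rfl
    simp only [Pi.smul_apply, A, Pi.add_apply, this, add_zero]
  obtain ⟨σ, hσL, hσ⟩ := exists_solution_supported _ A hA tgt
  have hform : ∀ (r) (τ : ι → ZMod 2), ∑ t, g r t * (τ + σ) t =
      ∑ t, g r t * τ t + ∑ t, g r t * σ t := fun r τ => by
    rw [← Finset.sum_add_distrib]
    exact Finset.sum_congr rfl fun t _ => mul_add _ _ _
  have hAf : ∀ r, ∑ t, A r t * (ρ + σ) t = if r.1 then s r.2.1 r.2.2 else ad r.2.1 r.2.2 := by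
    intro r
    simp only [Pi.add_apply, mul_add, Finset.sum_add_distrib, hσ r, tgt]
    ring
  have had : ∀ j, lookupAddress g j (ρ + σ) = ad j := fun j => by
    funext b
    simpa [A, lookupAddress] using hAf (false, j, b)
  have had' : ∀ j, lookupAddress g j (ρ' + σ) = ad j := fun j => by
    rw [← had j]
    funext b
    simp only [lookupAddress]
    rw [hform, hform, hlin]
  have hmis : ∀ j, lookupMismatch pos g j (ρ + σ) = s j := fun j => by
    funext b
    have := hAf (true, j, b)
    simp only [A, if_true, Pi.add_apply, add_mul, Finset.sum_add_distrib] at this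
    have hsingle : ∑ t, (Pi.single (pos j (ad j) b) 1 : ι → ZMod 2) t * (ρ t + σ t) =
        ρ (pos j (ad j) b) + σ (pos j (ad j) b) := by
      rw [Finset.sum_eq_single (pos j (ad j) b) (fun t _ ht => by simp [ht]) (by simp)]
      simp
    rw [hsingle] at this
    rw [lookupMismatch, had]
    exact this
  have hmis' : ∀ j, lookupMismatch pos g j (ρ' + σ) = s j + δ j := fun j => by
    rw [← hmis j]
    funext b
    simp only [lookupMismatch, had, had', Pi.add_apply, δ]
    have h := hform (true, j, b) ρ
    have h' := hform (true, j, b) ρ'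
    simp only [Pi.add_apply] at h h'
    rw [h, h', hlin]
    ring
  refine ⟨σ, fun t ht => hσL t (by simpa using ht), ?_⟩
  simp [lookupParity, hmis, hmis', hs0, hsδ]

/-! ### The lower bound -/

/-- There is a cut that separates exactly `d` of the variables from the others. -/
theorem exists_cut {n d : ℕ} {e : ι → Fin n} (he : Function.Injective e)
    (hd : d ≤ Fintype.card ι) :
    ∃ u ≤ n, (Finset.univ.filter fun t => (e t).val < u).card = d := by
  induction d with
  | zero => exact ⟨0, Nat.zero_le _, by simp⟩
  | succ d ih =>
    classical
    have hex : ∃ u, d + 1 ≤ (Finset.univ.filter fun t => (e t).val < u).card :=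
      ⟨n, by simpa [Finset.filter_true_of_mem] using hd⟩
    have hspec := Nat.find_spec hex
    have hle : Nat.find hex ≤ n :=
      Nat.find_min' hex (by simpa [Finset.filter_true_of_mem] using hd)
    refine ⟨Nat.find hex, hle, le_antisymm ?_ hspec⟩
    obtain ⟨u, hu⟩ : ∃ u, Nat.find hex = u + 1 := by
      refine Nat.exists_eq_succ_of_ne_zero fun h0 => ?_
      rw [h0] at hspec
      simp at hspec
    have hmin := Nat.find_min hex (m := u) (by omega)
    rw [hu]
    have hsub : (Finset.univ.filter fun t => (e t).val < u + 1) ⊆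
        (Finset.univ.filter fun t => (e t).val < u) ∪
          Finset.univ.filter fun t => (e t).val = u := by
      intro t ht
      simp only [Finset.mem_filter, Finset.mem_univ, true_and, Finset.mem_union] at ht ⊢
      omega
    have hone : (Finset.univ.filter fun t => (e t).val = u).card ≤ 1 := by
      refine Finset.card_le_one.2 fun t ht t' ht' => he (Fin.ext ?_)
      rw [(Finset.mem_filter.1 ht).2, (Finset.mem_filter.1 ht').2]
    have := (Finset.card_le_card hsub).trans (Finset.card_union_le _ _)
    omega

/-- Every program for the table lookup function, whatever its order of the variables, satisfies
`k * v * log₂ v ≥ 62 * τ`, where `1024 * τ` is the number of table bits. At the cut before which a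
sixteenth of the table bits are read, the signature of an assignment and its values of the linear
forms determine these bits. -/
theorem two_pow_le_of_computes_lookup {pos : Fin K → (Fin p → ZMod 2) → Fin p → ι}
    (hpos : ∀ t, ∃ i a b, pos i a b = t) {g : Bool × Fin K × Fin p → ι → ZMod 2} (hp : 2 ≤ p)
    {τ : ℕ} (hι : Fintype.card ι = 1024 * τ) (hKp : K * p ≤ τ)
    (hg : ∀ c : Bool × Fin K × Fin p → ZMod 2, c ≠ 0 → 128 * τ < hammingNorm (∑ r, c r • g r))
    {n k v : ℕ} {e : ι → Fin n} (he : Function.Injective e) {f : (Fin n → Bool) → Bool}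
    (hf : ∀ x, f x = lookupParity pos g fun t => if x (e t) then 1 else 0)
    (P : KOBDD k n) (hv : P.width ≤ v) (hP : P.Computes f) :
    2 ^ (62 * τ) ≤ v ^ (v * k) := by
  classical
  have hz : ∀ z : ZMod 2, (if decide (z = 1) then (1 : ZMod 2) else 0) = z := by decide
  obtain ⟨π, hπ⟩ := KOBDD.exists_signature P hv hP
  obtain ⟨u, hu, hL⟩ := exists_cut (e := fun t => π.symm (e t)) (π.symm.injective.comp he)
    (d := 64 * τ) (by omega)
  obtain ⟨sig, hsig, hfsig⟩ := hπ u hu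
  set L := Finset.univ.filter fun t => (π.symm (e t)).val < u with hLdef
  let X : (ι → ZMod 2) → Fin n → Bool := fun y =>
    Function.extend e (fun t => decide (y t = 1)) fun _ => false
  have hX : ∀ y t, X y (e t) = decide (y t = 1) := fun y t => he.extend_apply _ _ _
  have hfX : ∀ y, f (X y) = lookupParity pos g y := fun y => by
    rw [hf]
    simp only [hX, hz]
  have hXcongr : ∀ (y y' : ι → ZMod 2) (j : Fin n), (∀ t, e t = j → y t = y' t) →
      X y j = X y' j := by
    intro y y' j h
    by_cases hj : ∃ t, e t = j
    · obtain ⟨t, rfl⟩ := hj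
      rw [hX, hX, h t rfl]
    · simp [X, Function.extend_apply' _ _ _ hj]
  let ext : (L → ZMod 2) → ι → ZMod 2 := fun z t => if h : t ∈ L then z ⟨t, h⟩ else 0
  have hinj : Function.Injective fun z : L → ZMod 2 =>
      (sig (X (ext z)), fun r => ∑ t, g r t * ext z t) := by
    intro z z' hzz
    by_contra hne
    rw [Prod.mk.injEq] at hzz
    have hext : ext z ≠ ext z' := fun h => hne <| by
      funext t
      simpa [ext] using congrFun h t
    obtain ⟨σ, hσ, hsep⟩ := exists_separating hpos hp L
      (fun c hc => (show L.card + K * p ≤ 128 * τ by omega).trans_lt (hg c hc)) hext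
      (congrFun hzz.2)
    have hbefore : ∀ z, sig (X (ext z + σ)) = sig (X (ext z)) := fun z => by
      refine hsig _ _ fun j hj => hXcongr _ _ _ fun t ht => ?_
      have : t ∈ L := by simp [hLdef, ht, hj]
      simp [hσ t this]
    refine hsep ?_
    rw [← hfX, ← hfX]
    refine hfsig _ _ (fun j hj => hXcongr _ _ _ fun t ht => ?_)
      (by rw [hbefore, hbefore, hzz.1])
    have : t ∉ L := by simp [hLdef, ht, hj]
    simp [ext, this]
  have hcard := Fintype.card_le_of_injective _ hinj
  simp only [Fintype.card_prod, Fintype.card_fun, ZMod.card, Fintype.card_fin, Fintype.card_coe,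
    Fintype.card_bool, hL] at hcard
  rw [← pow_mul] at hcard
  have hle : 2 ^ (62 * τ) * 2 ^ (2 * (K * p)) ≤ v ^ (v * k) * 2 ^ (2 * (K * p)) := by
    rw [← pow_add]
    exact (Nat.pow_le_pow_right two_pos (by omega)).trans hcard
  exact Nat.le_of_mul_le_mul_right hle (by positivity)

end TableLookup

/-! ### The upper bound -/

namespace KOBDD

variable {p : ℕ}

/-- The step of a layer that adds up the columns `G q` of a matrix over the positions `q` at which
the input bit is `1`. -/
def linearCore {A T : Type*} (G : ℕ → Fin p → ZMod 2) (q : ℕ) (b : Bool)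
    (s : A × T × (Fin p → ZMod 2)) : A × T × (Fin p → ZMod 2) :=
  (s.1, s.2.1, s.2.2 + if b then G q else 0)

theorem run_linearCore {A T : Type*} (G : ℕ → Fin p → ZMod 2) (s : A × T × (Fin p → ZMod 2))
    (β : ℕ → Bool) (q : ℕ) :
    run (linearCore G) s β q =
      (s.1, s.2.1, s.2.2 + ∑ j ∈ Finset.range q, if β j then G j else 0) := by
  induction q with
  | zero => simp [run]
  | succ q ih => rw [run, ih, Finset.sum_range_succ, linearCore, add_assoc]

/-- The step of a layer that replaces an address `a` by the table entry at this address, which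
consists of the `p` bits from position `p * E a` on. The tag in the state is `0` while the entry is
still to come, `1` while it is being read, and `2` afterwards. The address need not be kept once the
entry begins, since the end of the entry is seen from the position. -/
def loadCore {A : Type*} (E : (Fin p → ZMod 2) → ℕ) (q : ℕ) (b : Bool)
    (s : A × Fin 3 × (Fin p → ZMod 2)) : A × Fin 3 × (Fin p → ZMod 2) :=
  if s.2.1 = 0 then
    if q / p = E s.2.2 then (s.1, 1, fun c => if c.val = q % p then (if b then 1 else 0) else 0)
    else s
  else if s.2.1 = 1 then
    if q % p = 0 then (s.1, 2, s.2.2)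
    else (s.1, 1, fun c => if c.val = q % p then (if b then 1 else 0) else s.2.2 c)
  else s

theorem run_loadCore {A : Type*} (hp : 0 < p) (E : (Fin p → ZMod 2) → ℕ) (acc : A)
    (a : Fin p → ZMod 2) (β : ℕ → Bool) (q : ℕ) :
    run (loadCore E) (acc, 0, a) β q =
      (acc, if q ≤ p * E a then (0, a) else (if q ≤ p * E a + p then 1 else 2,
        fun c => if p * E a + c < q ∧ β (p * E a + c) then 1 else 0)) := by
  induction q with
  | zero => simp [run]
  | succ q ih =>
    rw [run, ih]
    rcases lt_or_ge q (p * E a) with h | h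
    · have hq : q / p ≠ E a := (Nat.div_lt_of_lt_mul h).ne
      simp [loadCore, h.le, Nat.succ_le_of_lt h, hq]
    · obtain ⟨d, rfl⟩ := Nat.exists_eq_add_of_le h
      rcases Nat.eq_zero_or_pos d with rfl | hd
      · have hp' : p * E a + 1 ≤ p * E a + p := by omega
        simp only [Nat.add_zero, le_refl, if_true, loadCore,
          Nat.mul_div_cancel_left _ hp, Nat.mul_mod_right, Nat.not_succ_le_self, if_false, hp']
        refine Prod.ext rfl (Prod.ext rfl (funext fun c => ?_))
        by_cases hc : c.val = 0
        · simp [hc]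
        · have : ¬ p * E a + c.val < p * E a + 1 := by omega
          simp [hc, this]
      · have h1 : ¬ p * E a + d ≤ p * E a := by omega
        have h2 : ¬ p * E a + d + 1 ≤ p * E a := by omega
        simp only [h1, h2, if_false]
        rcases lt_trichotomy d p with hdp | hdp | hdp
        · have h3 : p * E a + d ≤ p * E a + p := by omega
          have h4 : p * E a + d + 1 ≤ p * E a + p := by omega
          have h5 : (p * E a + d) % p = d := by
            rw [Nat.mul_add_mod, Nat.mod_eq_of_lt hdp]
          simp only [loadCore, h3, h4, h5, if_true, hd.ne', if_false, one_ne_zero]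
          refine Prod.ext rfl (Prod.ext rfl (funext fun c => ?_))
          by_cases hc : c.val = d
          · simp [hc]
          · have : p * E a + c.val < p * E a + d + 1 ↔ p * E a + c.val < p * E a + d := by omega
            simp [hc, this]
        · subst hdp
          have h4 : ¬ d * E a + d + 1 ≤ d * E a + d := by omega
          have h5 : (d * E a + d) % d = 0 := by simp
          simp only [loadCore, le_refl, h4, h5, if_true, if_false, one_ne_zero]
          refine Prod.ext rfl (Prod.ext rfl (funext fun c => ?_))
          have h6 : d * E a + c.val < d * E a + d := by omega
          have h7 : d * E a + c.val < d * E a + d + 1 := by omega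
          simp [h6, h7]
        · have h3 : ¬ p * E a + d ≤ p * E a + p := by omega
          have h4 : ¬ p * E a + d + 1 ≤ p * E a + p := by omega
          have h20 : (2 : Fin 3) ≠ 0 := by decide
          have h21 : (2 : Fin 3) ≠ 1 := by decide
          simp only [loadCore, h3, h4, if_false, h20, h21]
          refine Prod.ext rfl (Prod.ext rfl (funext fun c => ?_))
          have h6 : p * E a + c.val < p * E a + d := by omega
          have h7 : p * E a + c.val < p * E a + d + 1 := by omega
          simp [h6, h7]

variable (GA GT : ℕ → ℕ → Fin p → ZMod 2) (E : ℕ → (Fin p → ZMod 2) → ℕ)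

/-- The steps of the lookup program, which spends three layers on each table: the first one computes
the address, the second one loads the entry, and the third one adds the test word. -/
def lookupCore (i q : ℕ) (b : Bool) (s : ZMod 2 × Fin 3 × (Fin p → ZMod 2)) :
    ZMod 2 × Fin 3 × (Fin p → ZMod 2) :=
  if i % 3 = 0 then linearCore (GA (i / 3)) q b s
  else if i % 3 = 1 then loadCore (E (i / 3)) q b s
  else linearCore (GT (i / 3)) q b s

/-- What the lookup program does in addition at the end of a layer. After the third layer for a
table, the comparison of entry and test word is recorded, and the register is cleared. -/
def lookupPost (i : ℕ) (s : ZMod 2 × Fin 3 × (Fin p → ZMod 2)) :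
    ZMod 2 × Fin 3 × (Fin p → ZMod 2) :=
  if i % 3 = 0 then s
  else if i % 3 = 1 then (s.1, 0, s.2.2)
  else (s.1 + if s.2.2 = 0 then 1 else 0, 0, 0)

theorem run_lookup {n K : ℕ} (hp : 0 < p) (hn : 0 < n) (hE : ∀ i < K, ∀ a, p * E i a + p ≤ n)
    (x : Fin n → Bool) {i : ℕ} (hi : i ≤ K) :
    run (layerStep n (lookupCore GA GT E) lookupPost) (0, 0, 0) (bitAt 1 x) (3 * i * n) =
      (∑ i ∈ Finset.range i, if
        ((fun c : Fin p => if bitAt 1 x (p * E i (∑ j ∈ Finset.range n,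
            if bitAt 1 x j then GA i j else 0) + c) then 1 else 0) +
          ∑ j ∈ Finset.range n, if bitAt 1 x j then GT i j else 0) = 0 then 1 else 0, 0, 0) := by
  induction i with
  | zero => simp [run]
  | succ i ih =>
    have m0 : 3 * i % 3 = 0 := by omega
    have m1 : (3 * i + 1) % 3 = 1 := by omega
    have m2 : (3 * i + 1 + 1) % 3 = 2 := by omega
    have d0 : 3 * i / 3 = i := by omega
    have d1 : (3 * i + 1) / 3 = i := by omega
    have d2 : (3 * i + 1 + 1) / 3 = i := by omega
    have c0 : lookupCore GA GT E (3 * i) = linearCore (GA i) := by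
      funext q b s; simp [lookupCore, d0]
    have c1 : lookupCore GA GT E (3 * i + 1) = loadCore (E i) := by
      funext q b s; simp [lookupCore, m1, d1]
    have c2 : lookupCore GA GT E (3 * i + 1 + 1) = linearCore (GT i) := by
      funext q b s; simp [lookupCore, m2, d2]
    rw [show 3 * (i + 1) = 3 * i + 1 + 1 + 1 by ring, run_layerStep hn, run_layerStep hn,
      run_layerStep hn, ih (by omega), c0, c1, c2, run_linearCore, Finset.sum_range_succ]
    simp only [lookupPost, m0, m1, m2, if_true, if_false, zero_add, run_loadCore hp,
      run_linearCore, one_ne_zero, OfNat.ofNat_ne_zero, OfNat.ofNat_ne_one]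
    set a := ∑ j ∈ Finset.range n, if bitAt 1 x j then GA i j else 0
    have hEa := hE i (by omega) a
    have hna : ¬ n ≤ p * E i a := by omega
    have hlt : ∀ c : Fin p, p * E i a + c.val < n := fun c => by omega
    simp only [hna, hlt, if_false, true_and]

end KOBDD

/-- The place of bit `b` of the entry of table `i` at the address `a`, when all entries are listed
one after the other; `ν` numbers the addresses. -/
def tablePos {K p : ℕ} (ν : (Fin p → ZMod 2) ≃ Fin (2 ^ p)) (i : Fin K) (a : Fin p → ZMod 2)
    (b : Fin p) : Fin (K * 2 ^ p * p) :=
  finProdFinEquiv (finProdFinEquiv (i, ν a), b)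

theorem tablePos_surjective {K p : ℕ} (ν : (Fin p → ZMod 2) ≃ Fin (2 ^ p))
    (t : Fin (K * 2 ^ p * p)) : ∃ i a b, tablePos ν i a b = t := by
  obtain ⟨⟨e, b⟩, rfl⟩ := finProdFinEquiv.surjective t
  obtain ⟨⟨i, a'⟩, rfl⟩ := finProdFinEquiv.surjective e
  exact ⟨i, ν.symm a', b, by simp [tablePos]⟩

theorem exists_computes_lookup {K p n k : ℕ} (hp : 0 < p) (hn : 0 < n) (hk : 3 * K ≤ k)
    (hT : K * 2 ^ p * p ≤ n) (ν : (Fin p → ZMod 2) ≃ Fin (2 ^ p))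
    (g : Bool × Fin K × Fin p → Fin (K * 2 ^ p * p) → ZMod 2) {f : (Fin n → Bool) → Bool}
    (hf : ∀ x, f x = lookupParity (tablePos ν) g fun t => if x (Fin.castLE hT t) then 1 else 0) :
    ∃ P : KOBDD k n, P.width ≤ 6 * 2 ^ p ∧ P.Computes f := by
  let G : Bool → ℕ → ℕ → Fin p → ZMod 2 := fun s i q b =>
    if h : i < K ∧ q < K * 2 ^ p * p then g (s, ⟨i, h.1⟩, b) ⟨q, h.2⟩ else 0
  let E : ℕ → (Fin p → ZMod 2) → ℕ := fun i a => (ν a).val + 2 ^ p * i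
  have hE : ∀ i < K, ∀ a, p * E i a + p ≤ n := by
    intro i hi a
    refine le_trans ?_ hT
    have h1 : E i a + 1 ≤ K * 2 ^ p := by
      have h2 : (ν a).val + 1 ≤ 2 ^ p := (ν a).isLt
      have h3 : 2 ^ p * (i + 1) ≤ 2 ^ p * K := Nat.mul_le_mul_left _ hi
      simp only [E]
      nlinarith
    calc p * E i a + p = (E i a + 1) * p := by ring
      _ ≤ _ := Nat.mul_le_mul_right p h1
  have hprog : ∃ P : KOBDD (3 * K) n, P.width ≤ 6 * 2 ^ p ∧ P.Computes f := by
    refine KOBDD.exists_computes_of_run (S := ZMod 2 × Fin 3 × (Fin p → ZMod 2)) ?_ 1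
      (KOBDD.layerStep n (KOBDD.lookupCore (G false) (G true) E) KOBDD.lookupPost)
      (0, 0, 0) (1, 0, 0) fun x => ?_
    · simp only [Fintype.card_prod, ZMod.card, Fintype.card_fin, Fintype.card_fun]
      omega
    rw [KOBDD.run_lookup _ _ _ hp hn hE x le_rfl, hf x, lookupParity, decide_eq_true_eq,
      Finset.sum_range]
    set y : Fin (K * 2 ^ p * p) → ZMod 2 := fun t => if x (Fin.castLE hT t) then 1 else 0 with hy
    have hbit : ∀ t : Fin (K * 2 ^ p * p), KOBDD.bitAt 1 x t = x (Fin.castLE hT t) := fun t => by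
      have ht : t.val < n := t.isLt.trans_le hT
      simp only [KOBDD.bitAt, hn, dif_pos, Equiv.Perm.one_apply, Nat.mod_eq_of_lt ht]
      rfl
    have hform : ∀ (s : Bool) (i : Fin K),
        (∑ j ∈ Finset.range n, if KOBDD.bitAt 1 x j then G s i j else 0) =
          fun b => ∑ t, g (s, i, b) t * y t := by
      intro s i
      funext b
      obtain ⟨d, rfl⟩ := Nat.exists_eq_add_of_le hT
      rw [Finset.sum_range_add, Finset.sum_range, Pi.add_apply, Finset.sum_apply,
        Finset.sum_eq_zero (s := Finset.range d), Pi.zero_apply, add_zero]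
      · refine Finset.sum_congr rfl fun t _ => ?_
        rw [hbit]
        simp only [hy, G]
        split_ifs <;> simp_all
      · intro j _
        split_ifs
        · funext b
          exact dif_neg (by omega)
        · rfl
    have hmis : ∀ i : Fin K,
        ((fun c : Fin p => if KOBDD.bitAt 1 x (p * E i (∑ j ∈ Finset.range n,
            if KOBDD.bitAt 1 x j then G false i j else 0) + c) then 1 else 0) +
          ∑ j ∈ Finset.range n, if KOBDD.bitAt 1 x j then G true i j else 0) =
        lookupMismatch (tablePos ν) g i y := by
      intro i
      rw [hform, hform]
      funext c
      rw [Pi.add_apply, add_comm, lookupMismatch]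
      congr 1
      have hplace : p * E i (fun b => ∑ t, g (false, i, b) t * y t) + c.val =
          (tablePos ν i (lookupAddress g i y) c).val := by
        simp only [tablePos, finProdFinEquiv_apply_val, E]
        rw [add_comm]
        rfl
      rw [hplace, hbit]
    simp only [hmis]
    simp
  obtain ⟨P, hv, hP⟩ := hprog
  exact KOBDD.exists_computes_of_le (Nat.mul_le_mul_right n hk) P hv hP

/-! ### Choice of the parameters -/

/-- A Boolean function in `n` variables that is computed with `k` layers and width `384 * w`, while
`k' * v * log₂ v` is large for all programs that compute it. -/
theorem exists_hard_function {k w n : ℕ} (hk : 4 < k) (hw : 20 < w)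
    (hn : 64 * ((k : ℝ) * w * Real.logb 2 w) ≤ n) :
    ∃ f : (Fin n → Bool) → Bool,
      (∃ P : KOBDD k n, P.width ≤ 384 * w ∧ P.Computes f) ∧
      ∀ (k' v : ℕ) (P : KOBDD k' n), P.width ≤ v → P.Computes f →
        (k : ℝ) * w * Real.logb 2 w ≤ 48 * (k' * (v * Real.logb 2 v)) := by
  have hw0 : w ≠ 0 := by omega
  set l := Nat.log 2 w with hl
  have hl4 : 4 ≤ l := Nat.le_log_of_pow_le one_lt_two (by omega)
  have hlw : 2 ^ l ≤ w := Nat.pow_log_le_self 2 hw0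
  have hwl : w < 2 ^ (l + 1) := Nat.lt_pow_succ_log_self one_lt_two w
  have hlog1 : (l : ℝ) ≤ Real.logb 2 w := by
    rw [Real.le_logb_iff_rpow_le one_lt_two (by positivity), Real.rpow_natCast]
    exact_mod_cast hlw
  have hlog2 : Real.logb 2 w ≤ (l + 1 : ℕ) := by
    rw [Real.logb_le_iff_le_rpow one_lt_two (by positivity), Real.rpow_natCast]
    exact_mod_cast hwl.le
  set p := l + 6 with hp
  set K := k / 3 with hK
  have hK3 : 3 * K ≤ k := Nat.mul_div_le k 3
  have hK5 : k ≤ 5 * K := by omega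
  set τ := K * p * 2 ^ (l - 4) with hτ
  have hpow : 2 ^ p = 1024 * 2 ^ (l - 4) := by
    rw [show p = 10 + (l - 4) by omega, pow_add]; norm_num
  have hpowl : 2 ^ l = 16 * 2 ^ (l - 4) := by
    conv_lhs => rw [show l = 4 + (l - 4) by omega, pow_add]
    norm_num
  have hpow1 : 1 ≤ 2 ^ (l - 4) := Nat.one_le_two_pow
  have hTτ : K * 2 ^ p * p = 1024 * τ := by rw [hpow, hτ]; ring
  have hKpτ : K * p ≤ τ := Nat.le_mul_of_pos_right _ hpow1
  have hτ0 : 0 < τ := by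
    have : 0 < K := by omega
    positivity
  have hkwpos : (0 : ℝ) ≤ (k : ℝ) * w := by positivity
  have hT : K * 2 ^ p * p ≤ n := by
    have h1 : 2 ^ p ≤ 64 * w := by rw [hp, pow_add]; omega
    have h2 : 2 * p ≤ 5 * l := by omega
    have h3 : K * 2 ^ p * p ≤ 64 * (k * w * l) := by
      have : 6 * (K * 2 ^ p * p) ≤ 5 * (64 * (k * w * l)) := by
        calc 6 * (K * 2 ^ p * p) = (3 * K) * 2 ^ p * (2 * p) := by ring
          _ ≤ k * (64 * w) * (5 * l) := Nat.mul_le_mul (Nat.mul_le_mul hK3 h1) h2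
          _ = _ := by ring
      omega
    have h4 : ((64 * (k * w * l) : ℕ) : ℝ) ≤ n := by
      refine le_trans ?_ hn
      push_cast
      exact mul_le_mul_of_nonneg_left (mul_le_mul_of_nonneg_left hlog1 hkwpos) (by norm_num)
    exact h3.trans (by exact_mod_cast h4)
  have hn0 : 0 < n := lt_of_lt_of_le (by omega) hT
  let ν : (Fin p → ZMod 2) ≃ Fin (2 ^ p) := Fintype.equivFinOfCardEq (by simp)
  obtain ⟨g, hg⟩ := exists_code (ι := Fin (K * 2 ^ p * p)) (R := Bool × Fin K × Fin p) hτ0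
    (by rw [Fintype.card_fin, hTτ]) (by simpa using hKpτ)
  refine ⟨fun x => lookupParity (tablePos ν) g fun t => if x (Fin.castLE hT t) then 1 else 0,
    ?_, fun k' v P hv hP => ?_⟩
  · obtain ⟨P, hv, hP⟩ := exists_computes_lookup (by omega) hn0 hK3 hT ν g fun _ => rfl
    refine ⟨P, hv.trans ?_, hP⟩
    rw [hp, pow_add]
    omega
  · have hmain := two_pow_le_of_computes_lookup (tablePos_surjective ν) (by omega)
      (by rw [Fintype.card_fin, hTτ]) hKpτ hg (Fin.castLE_injective hT) (fun _ => rfl) P hv hP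
    have hv0 : 0 < v := by
      refine lt_of_lt_of_le (Fin.pos P.source) (le_trans ?_ hv)
      exact Finset.le_sup (f := P.size) (Finset.mem_range.2 (Nat.succ_pos _))
    have hlogs : ((62 * τ : ℕ) : ℝ) ≤ k' * (v * Real.logb 2 v) := by
      have h1 : ((2 : ℝ)) ^ (62 * τ) ≤ (v : ℝ) ^ (v * k') := by exact_mod_cast hmain
      have h2 := Real.logb_le_logb_of_le one_lt_two (by positivity) h1
      rw [Real.logb_pow, Real.logb_pow, Real.logb_self_eq_one one_lt_two, mul_one] at h2
      refine h2.trans_eq ?_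
      push_cast
      ring
    have hbound : (k : ℝ) * w * Real.logb 2 w ≤ 48 * ((62 * τ : ℕ) : ℝ) := by
      have h1 : k * w * (l + 1) ≤ 48 * (62 * τ) := by
        calc k * w * (l + 1) ≤ (5 * K) * (2 ^ (l + 1)) * p :=
              Nat.mul_le_mul (Nat.mul_le_mul hK5 hwl.le) (by omega)
          _ = 160 * τ := by rw [pow_succ, hpowl, hτ]; ring
          _ ≤ _ := by omega
      refine (mul_le_mul_of_nonneg_left hlog2 hkwpos).trans ?_
      exact_mod_cast h1
    exact hbound.trans (mul_le_mul_of_nonneg_left hlogs (by norm_num))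

theorem theorem8
    (C : Set (ℕ → ℕ))
    (hC : C = constWidth ∨ C = superpolylogWidth ∨
      ∃ α : ℝ, 0 < α ∧ α < 1 / 2 ∧ C = sublinearWidth α)
    (k w : ℕ → ℕ) (r : ℕ → ℝ)
    (hw : w ∈ C)
    (hk4 : ∀ᶠ n in atTop, 4 < k n)
    (hw20 : ∀ᶠ n in atTop, 20 < w n)
    (hkw : (fun n : ℕ => (k n : ℝ) * (w n : ℝ) * Real.logb 2 (w n : ℝ))
      =o[atTop] fun n : ℕ => (n : ℝ))
    (hr : ∀ v ∈ C, ∀ᶠ n in atTop,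
      48 * (v n : ℝ) * Real.logb 2 (v n : ℝ) / ((w n : ℝ) * Real.logb 2 (w n : ℝ)) < r n) :
    OBDDClass (fun n => ⌊(k n : ℝ) / r n⌋₊) C ⊂ OBDDClass k C := by
  have hclosed : ∀ v ∈ C, ∀ c : ℕ, 1 ≤ c → ∀ d : ℕ, (fun n => c * v n + d) ∈ C :=
    fun v hv c hc d => mul_add_mem_width hC hv hc d
  have hlogpos : ∀ n, 20 < w n → 0 < (w n : ℝ) * Real.logb 2 (w n) := fun n hn => by
    have : (1 : ℝ) < w n := by exact_mod_cast (by omega : 1 < w n)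
    exact mul_pos (by linarith) (Real.logb_pos one_lt_two this)
  have hr1 : ∀ᶠ n in atTop, 1 ≤ r n := by
    filter_upwards [hr w hw, hw20] with n hn hwn
    have := hlogpos n hwn
    rw [mul_assoc, mul_div_assoc, div_self this.ne'] at hn
    linarith
  have hle : ∀ᶠ n in atTop, ⌊(k n : ℝ) / r n⌋₊ ≤ k n := by
    filter_upwards [hr1] with n hn
    exact Nat.floor_le_of_le (div_le_self (Nat.cast_nonneg _) hn)
  refine LE.le.ssubset_of_not_superset
    (OBDDClass_subset_of_eventually_le (fun v hv d => by simpa using hclosed v hv 1 le_rfl d) hle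
      fun n h0 => by simp [h0]) ?_
  have hsmall : ∀ᶠ n in atTop, 64 * ((k n : ℝ) * w n * Real.logb 2 (w n)) ≤ n := by
    filter_upwards [hkw.bound (show (0 : ℝ) < 1 / 64 by norm_num)] with n hn
    rw [Real.norm_of_nonneg (Nat.cast_nonneg n)] at hn
    have := (le_abs_self _).trans hn
    linarith
  -- The hard function where the hypotheses hold, a constant one for the other `n`.
  have hf : ∀ n, ∃ f : (Fin n → Bool) → Bool,
      (∃ P : KOBDD (k n) n, P.width ≤ 384 * w n + 2 ∧ P.Computes f) ∧
      (4 < k n → 20 < w n → 64 * ((k n : ℝ) * w n * Real.logb 2 (w n)) ≤ n →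
        ∀ (k' v : ℕ) (P : KOBDD k' n), P.width ≤ v → P.Computes f →
          (k n : ℝ) * w n * Real.logb 2 (w n) ≤ 48 * (k' * (v * Real.logb 2 v))) := by
    intro n
    by_cases h : 4 < k n ∧ 20 < w n ∧ 64 * ((k n : ℝ) * w n * Real.logb 2 (w n)) ≤ n
    · obtain ⟨f, ⟨P, hv, hP⟩, hlow⟩ := exists_hard_function h.1 h.2.1 h.2.2
      exact ⟨f, ⟨P, hv.trans (Nat.le_add_right _ _), hP⟩, fun _ _ _ => hlow⟩
    · obtain ⟨P, hv, hP⟩ := KOBDD.exists_computes_false (k n) n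
      exact ⟨_, ⟨P, hv.trans (Nat.le_add_left _ _), hP⟩, fun h1 h2 h3 => (h ⟨h1, h2, h3⟩).elim⟩
  choose f hup hlow using hf
  intro hsub
  obtain ⟨v, hv, hcomp⟩ := hsub ⟨_, hclosed w hw 384 (by norm_num) 2, hup⟩
  obtain ⟨n, hkn, hwn, hn, hrn, hr1n⟩ :=
    (hk4.and (hw20.and (hsmall.and ((hr v hv).and hr1)))).exists
  obtain ⟨P, hPv, hP⟩ := hcomp n
  have h1 := hlow n hkn hwn hn _ _ P hPv hP
  have hL := hlogpos n hwn
  set A : ℝ := (w n : ℝ) * Real.logb 2 (w n)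
  set B : ℝ := (v n : ℝ) * Real.logb 2 (v n) with hB
  have hkpos : (0 : ℝ) < k n := by exact_mod_cast (by omega : 0 < k n)
  have hr0 : 0 < r n := by linarith
  have hB0 : 0 ≤ B := mul_nonneg (Nat.cast_nonneg _)
    (div_nonneg (Real.log_natCast_nonneg _) (Real.log_nonneg one_le_two))
  have hfloor : (⌊(k n : ℝ) / r n⌋₊ : ℝ) ≤ k n / r n := Nat.floor_le (by positivity)
  rw [mul_assoc, ← hB, div_lt_iff₀ hL] at hrn
  have h2 : (k n : ℝ) * A ≤ 48 * (k n / r n * B) := by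
    rw [← mul_assoc]
    exact h1.trans (mul_le_mul_of_nonneg_left (mul_le_mul_of_nonneg_right hfloor hB0) (by norm_num))
  have h3 : (k n : ℝ) * A * r n ≤ k n * (48 * B) := by
    calc (k n : ℝ) * A * r n ≤ 48 * (k n / r n * B) * r n := mul_le_mul_of_nonneg_right h2 hr0.le
      _ = _ := by field_simp
  have h4 : (k n : ℝ) * (48 * B) < k n * (r n * A) := mul_lt_mul_of_pos_left hrn hkpos
  rw [mul_comm (r n), ← mul_assoc _ A] at h4
  exact (h3.trans_lt h4).false
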